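/- \textbf{Theorem (Wavelet Plancherel theorem).} Let $G$ be a locally compact topological group with left Haar measure $\mu$, and let $\pi$ be a square integrable representation of $G$ on a complex Hilbert space $\mathcal S$, i.e. a strongly continuous unitary representation whose only closed invariant subspaces are $\{0\}$ and $\mathcal S$, and which admits a nonzero window, a \emph{window} being a vector $f\in\mathcal S$ with $\big(g\mapsto\langle f,\pi(g)f\rangle\big)\in L^2(G)=L^2(G,\mu)$. Inner products are linear in the first argument. For a window $f$ and $s\in\mathcal S$ put $V_f[s](g)=\langle s,\pi(g)f\rangle$. There is a Duflo--Moore operator for $\pi$, i.e. a positive self-adjoint operator $K$ in $\mathcal S$ with densely defined inverse, whose domain $\mathrm{dom}(K)$ is the set of windows, such that $$\langle V_{f_1}[s_1],V_{f_2}[s_2]\rangle_{L^2(G)}=\langle s_1,s_2\rangle\,\langle Kf_2,Kf_1\rangle\qquad(f_1,f_2\in\mathrm{dom}(K),\ s_1,s_2\in\mathcal S).$$ Let $K$ be any such operator and let $\mathcal W$ be the completion of $\mathrm{dom}(K)$ under $\langle f_1,f_2\rangle_{\mathcal W}=\langle Kf_1,Kf_2\rangle$. Given orthonormal bases $(\phi_n)_n$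 of $\mathcal W$ and $(\eta_m)_m$ of $\mathcal S$, let $\mathcal W\otimes\mathcal S$ be the Hilbert space with orthonormal basis $(\phi_n\otimes\eta_m)_{n,m}$, and for $f=\sum_n c_n\phi_n\in\mathcal W$ and $s=\sum_m d_m\eta_m\in\mathcal S$ put $f\otimes s=\sum_{n,m}\overline{c_n}\,d_m\,\phi_n\otimes\eta_m$. Then there is a linear isometry $V:\mathcal W\otimes\mathcal S\to L^2(G)$ such that $$V(f\otimes s)=V_f[s]\qquad\text{for all } f\in\mathrm{dom}(K),\ s\in\mathcal S,$$ and $V$ is the only bounded linear map $\mathcal W\otimes\mathcal S\to L^2(G)$ with this property. In particular $V$ is an isometric isomorphism of $\mathcal W\otimes\mathcal S$ onto its image $V(\mathcal W\otimes\mathcal S)$. -/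

import Mathlib

open MeasureTheory
open scoped ENNReal ComplexConjugate

noncomputable section

section Wavelet

variable {G : Type*} [Group G] {S : Type*} [NormedAddCommGroup S] [InnerProductSpace ℂ S]

/-- The wavelet transform `V_f[s](g) = ⟨s, π(g) f⟩` (inner product linear in the first slot in this
formula; Mathlib's `inner` is linear in the second slot). -/
def waveletTransform (π : G →* (S ≃ₗᵢ[ℂ] S)) (f s : S) : G → ℂ :=
  fun g => inner ℂ (π g f) s

/-- A vector `f` is a window if `g ↦ ⟨f, π(g) f⟩` is square integrable. -/
def IsWindow [MeasurableSpace G] (π : G →* (S ≃ₗᵢ[ℂ] S)) (μ : Measure G) (f : S) : Prop :=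
  MemLp (waveletTransform π f f) 2 μ

/-- A square integrable representation: a unitary representation that is strongly continuous and
(topologically) irreducible, and that has a nonzero window. -/
structure IsSquareIntegrableRep [TopologicalSpace G] [MeasurableSpace G]
    (π : G →* (S ≃ₗᵢ[ℂ] S)) (μ : Measure G) : Prop where
  continuous : ∀ s : S, Continuous fun g => π g s
  irreducible : ∀ M : Submodule ℂ S, IsClosed (M : Set S) →
    (∀ g : G, ∀ v ∈ M, π g v ∈ M) → M = ⊥ ∨ M = ⊤
  exists_window : ∃ f : S, f ≠ 0 ∧ IsWindow π μ f

/-- `K` is the Duflo–Moore operator of `π` (with respect to `μ`): a positive self-adjoint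
(in particular densely defined) operator with densely defined inverse, whose domain is the set of
windows, such that `⟨V_{f₁}[s₁], V_{f₂}[s₂]⟩ = ⟨s₁, s₂⟩ ⟨K f₂, K f₁⟩`. In Mathlib's convention
`inner ℂ x y` is the product `⟨y, x⟩` of that formula. -/
structure IsDufloMoore [CompleteSpace S] [MeasurableSpace G] (π : G →* (S ≃ₗᵢ[ℂ] S))
    (μ : Measure G) (K : S →ₗ.[ℂ] S) : Prop where
  selfAdjoint : IsSelfAdjoint K
  nonneg : ∀ f : K.domain, 0 ≤ (inner ℂ (f : S) (K f)).re
  injective : Function.Injective K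
  denseRange : DenseRange K
  mem_domain : ∀ f : S, f ∈ K.domain ↔ IsWindow π μ f
  orthogonality : ∀ (f₁ f₂ : K.domain) (s₁ s₂ : S),
    ∫ g, waveletTransform π (f₁ : S) s₁ g * conj (waveletTransform π (f₂ : S) s₂ g) ∂μ =
      inner ℂ s₂ s₁ * inner ℂ (K f₁) (K f₂)

end Wavelet

section WindowSpace

variable {S : Type*} [NormedAddCommGroup S] [InnerProductSpace ℂ S]

/-- The domain of `K`, to be equipped with the inner product `⟨K f₁, K f₂⟩` instead of the one
inherited from `S`. -/
def WindowPreSpace (K : S →ₗ.[ℂ] S) : Type _ := K.domain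

variable (K : S →ₗ.[ℂ] S)

instance : AddCommGroup (WindowPreSpace K) := inferInstanceAs (AddCommGroup K.domain)

instance : Module ℂ (WindowPreSpace K) := inferInstanceAs (Module ℂ K.domain)

/-- `K` as a linear map on its domain. -/
def WindowPreSpace.map : WindowPreSpace K →ₗ[ℂ] S := K.toFun

instance : SeminormedAddCommGroup (WindowPreSpace K) :=
  SeminormedAddCommGroup.induced (WindowPreSpace K) S (WindowPreSpace.map K)

instance : InnerProductSpace ℂ (WindowPreSpace K) where
  inner f₁ f₂ := inner ℂ (WindowPreSpace.map K f₁) (WindowPreSpace.map K f₂)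
  norm_smul_le c f := by
    change ‖WindowPreSpace.map K (c • f)‖ ≤ ‖c‖ * ‖WindowPreSpace.map K f‖
    rw [map_smul, norm_smul]
  norm_sq_eq_re_inner f := norm_sq_eq_re_inner (𝕜 := ℂ) (WindowPreSpace.map K f)
  conj_inner_symm f₁ f₂ := inner_conj_symm _ _
  add_left f₁ f₂ f₃ := by rw [map_add, inner_add_left]
  smul_left f₁ f₂ c := by rw [map_smul, inner_smul_left]

/-- The window space `W`: the completion of `dom K` under `⟨K f₁, K f₂⟩`. -/
abbrev WindowSpace : Type _ := UniformSpace.Completion (WindowPreSpace K)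

/-- The canonical map from `dom K` to the window space. -/
def toWindowSpace (f : K.domain) : WindowSpace K :=
  ((show WindowPreSpace K from f : WindowPreSpace K) : UniformSpace.Completion (WindowPreSpace K))

end WindowSpace

section Tensor

variable {ι κ : Type*} {W S : Type*} [NormedAddCommGroup W] [InnerProductSpace ℂ W]
  [NormedAddCommGroup S] [InnerProductSpace ℂ S]

/-- The Hilbert space `W ⊗ S`, based on orthonormal bases `φ` of `W` and `η` of `S` with index sets
`ι` and `κ`: the Hilbert space with orthonormal basis `φ n ⊗ η m`, that is, `ℓ²(ι × κ)`. -/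
abbrev TensorSpace (_φ : HilbertBasis ι ℂ W) (_η : HilbertBasis κ ℂ S) : Type _ :=
  lp (fun _ : ι × κ => ℂ) 2

theorem memℓp_tensor (φ : HilbertBasis ι ℂ W) (η : HilbertBasis κ ℂ S) (f : W) (s : S) :
    Memℓp (fun p : ι × κ => conj (φ.repr f p.1) * η.repr s p.2) 2 := by
  have h2 : (0 : ℝ) < (2 : ℝ≥0∞).toReal := by norm_num
  apply memℓp_gen
  have h := Summable.mul_of_nonneg ((lp.memℓp (φ.repr f)).summable h2)
    ((lp.memℓp (η.repr s)).summable h2) (fun _ => by positivity) (fun _ => by positivity)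
  refine h.congr fun p => ?_
  rw [norm_mul, RCLike.norm_conj, Real.mul_rpow (norm_nonneg _) (norm_nonneg _)]

/-- The simple vector `f ⊗ s = ∑ conj(cₙ) dₘ φₙ ⊗ ηₘ` for `f = ∑ cₙ φₙ` and `s = ∑ dₘ ηₘ`. -/
def simpleTensor (φ : HilbertBasis ι ℂ W) (η : HilbertBasis κ ℂ S) (f : W) (s : S) :
    TensorSpace φ η :=
  ⟨fun p => conj (φ.repr f p.1) * η.repr s p.2, memℓp_tensor φ η f s⟩

end Tensor

end

/-! Everything rests on Schur's lemma. For a window f, the map s ↦ V_f[s] is bounded into L² and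
intertwines π with left translation, so for two windows the operator V_{f₂}* V_{f₁} is a scalar
c(f₁, f₂) (`exists_orthogonality`). For a fixed unit vector s₀ this scalar is the L² pairing of
V_{f₁}[s₀] with V_{f₂}[s₀]: a closed, strictly positive form, densely defined on the windows, hence
of the shape ⟨K f₂, K f₁⟩ with K positive self-adjoint (`exists_isSelfAdjoint_of_embedding`). That
V_f[s] is square integrable for every s as soon as f is a window is Schur's lemma applied to a
closed graph (`exists_mem_graph_of_irreducible`).

Given K, orthogonality yields ‖V_f[s]‖ = ‖K f‖ ‖s‖, so (f, s) ↦ V_f[s] extends to W × S and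
multiplies inner products. It sends the pairs (φₙ, ηₘ) to an orthonormal family, which defines V
(`exists_linearIsometry_tensorSpace`). V is unique because dom K is dense in W and the φₙ ⊗ ηₘ span
a dense subspace. -/

/-! ### Schur's lemma, bounded and in graph form. -/

section Schur

variable {G : Type*} [Group G] {S : Type*} [NormedAddCommGroup S] [InnerProductSpace ℂ S]
  [CompleteSpace S]

/-- Schur's lemma for self-adjoint operators and topologically irreducible unitary
representations. -/
theorem IsSelfAdjoint.exists_eq_smul_of_irreducible {π : G →* (S ≃ₗᵢ[ℂ] S)}
    (hirr : ∀ M : Submodule ℂ S, IsClosed (M : Set S) →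
      (∀ g : G, ∀ v ∈ M, π g v ∈ M) → M = ⊥ ∨ M = ⊤)
    {A : S →L[ℂ] S} (hA : IsSelfAdjoint A) (hcomm : ∀ g s, A (π g s) = π g (A s)) :
    ∃ c : ℝ, ∀ s, A s = (c : ℂ) • s := by
  rcases subsingleton_or_nontrivial S with hS | hS
  · exact ⟨0, fun s => Subsingleton.elim _ _⟩
  obtain ⟨c, hc⟩ := ContinuousFunctionalCalculus.spectrum_nonempty (R := ℝ) A hA
  -- The range of g(A) lies in the kernel of f(A), which is closed and invariant, hence trivial or
  -- everything.
  have key : ∀ f g : ℝ → ℝ, Continuous f → Continuous g → (∀ x, f x * g x = 0) →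
      cfc f A = 0 ∨ cfc g A = 0 := by
    intro f g hf hg hfg
    have hmul : cfc f A * cfc g A = 0 := by
      rw [← cfc_mul f g A hf.continuousOn hg.continuousOn]
      simp only [hfg]
      exact cfc_const_zero ℝ A
    rcases hirr (LinearMap.ker (cfc f A).toLinearMap) (cfc f A).isClosed_ker (fun g' v hv => by
        have hU : Commute A ((π g').toContinuousLinearEquiv : S →L[ℂ] S) := by
          ext s; exact hcomm g' s
        have := congrArg (fun T : S →L[ℂ] S => T v) (hU.cfc_real f).eq
        have hv' : (cfc f A) v = 0 := hv
        change (cfc f A) (π g' v) = 0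
        change (cfc f A) (π g' v) = π g' ((cfc f A) v) at this
        rw [this, hv', map_zero]) with h | h
    · right
      ext s
      have : (cfc g A) s ∈ LinearMap.ker (cfc f A).toLinearMap :=
        congrArg (fun T : S →L[ℂ] S => T s) hmul
      rw [h] at this
      exact this
    · left
      ext s
      have : s ∈ LinearMap.ker (cfc f A).toLinearMap := h ▸ Submodule.mem_top
      exact this
  -- Two spectral points would be separated by the positive and negative parts of x minus their
  -- midpoint: the product is zero, yet neither vanishes on the spectrum.
  have hlow : ∀ d ∈ spectrum ℝ A, ∀ e ∈ spectrum ℝ A, ¬ d < e := by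
    intro d hd e he hde
    have hcont1 : Continuous fun x : ℝ => max 0 (x - (d + e) / 2) := by fun_prop
    have hcont2 : Continuous fun x : ℝ => max 0 ((d + e) / 2 - x) := by fun_prop
    rcases key (fun x => max 0 (x - (d + e) / 2)) (fun x => max 0 ((d + e) / 2 - x))
      hcont1 hcont2 (fun x => by
        rcases le_total x ((d + e) / 2) with h | h
        · rw [max_eq_left (by linarith), zero_mul]
        · rw [max_eq_left (b := (d + e) / 2 - x) (by linarith), mul_zero]) with h | h
    · have h0 : cfc _ A = cfc (fun _ : ℝ => (0 : ℝ)) A := h.trans (cfc_const_zero ℝ A).symm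
      have := (cfc_eq_cfc_iff_eqOn (R := ℝ) (ha := hA) (hf := hcont1.continuousOn)
        (hg := continuousOn_const)).1 h0 he
      have h2 : e - (d + e) / 2 ≤ 0 := (le_max_right _ _).trans_eq this
      linarith
    · have h0 : cfc _ A = cfc (fun _ : ℝ => (0 : ℝ)) A := h.trans (cfc_const_zero ℝ A).symm
      have := (cfc_eq_cfc_iff_eqOn (R := ℝ) (ha := hA) (hf := hcont2.continuousOn)
        (hg := continuousOn_const)).1 h0 hd
      have h2 : (d + e) / 2 - d ≤ 0 := (le_max_right _ _).trans_eq this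
      linarith
  refine ⟨c, fun s => ?_⟩
  have h1 : cfc (id : ℝ → ℝ) A = cfc (fun _ : ℝ => c) A := cfc_congr fun x hx =>
    le_antisymm (not_lt.1 (hlow c hc x hx)) (not_lt.1 (hlow x hx c hc))
  rw [cfc_id ℝ A, cfc_const c A] at h1
  rw [h1, Algebra.algebraMap_eq_smul_one]
  simp

/-- Schur's lemma for bounded operators and topologically irreducible unitary representations. -/
theorem exists_eq_smul_of_irreducible {π : G →* (S ≃ₗᵢ[ℂ] S)}
    (hirr : ∀ M : Submodule ℂ S, IsClosed (M : Set S) →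
      (∀ g : G, ∀ v ∈ M, π g v ∈ M) → M = ⊥ ∨ M = ⊤)
    {A : S →L[ℂ] S} (hcomm : ∀ g s, A (π g s) = π g (A s)) :
    ∃ c : ℂ, ∀ s, A s = c • s := by
  have hinv : ∀ g s, π g⁻¹ (π g s) = s := fun g s => by
    rw [map_inv]; exact (π g).symm_apply_apply s
  have hadj : ∀ g s, A.adjoint (π g s) = π g (A.adjoint s) := by
    intro g s
    refine ext_inner_left ℂ fun v => ?_
    rw [ContinuousLinearMap.adjoint_inner_right, ← (π g⁻¹).inner_map_map (A v), hinv,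
      ← hcomm, ← ContinuousLinearMap.adjoint_inner_right, ← (π g).inner_map_map]
    congr 1
    have := hinv g⁻¹ v
    rwa [inv_inv] at this
  obtain ⟨a, ha⟩ := (IsSelfAdjoint.add_star_self A).exists_eq_smul_of_irreducible hirr
    (fun g s => by
      change A (π g s) + A.adjoint (π g s) = π g (A s + A.adjoint s)
      rw [hcomm, hadj, map_add])
  -- With A + A* = a and i(A - A*) = b both scalar, 2A = a - ib.
  have hB : IsSelfAdjoint (Complex.I • (A - star A)) := by
    rw [isSelfAdjoint_iff, star_smul, star_sub, star_star, Complex.star_def, Complex.conj_I,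
      neg_smul, ← smul_neg, neg_sub]
  obtain ⟨b, hb⟩ := hB.exists_eq_smul_of_irreducible hirr
    (fun g s => by
      change Complex.I • (A (π g s) - A.adjoint (π g s)) = π g (Complex.I • (A s - A.adjoint s))
      rw [hcomm, hadj, map_smul, map_sub])
  refine ⟨((a : ℂ) - Complex.I * b) / 2, fun s => ?_⟩
  have h1 : A s + A.adjoint s = (a : ℂ) • s := ha s
  have h2 : Complex.I • (A s - A.adjoint s) = (b : ℂ) • s := hb s
  have h3 : A s - A.adjoint s = -(Complex.I * b) • s := by
    rw [neg_smul, mul_smul, ← h2, smul_smul, Complex.I_mul_I, neg_smul, one_smul, neg_neg]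
  have h4 : (2 : ℂ) • A s = ((a : ℂ) - Complex.I * b) • s := by
    rw [sub_eq_add_neg, add_smul, ← h1, ← h3, two_smul]; abel
  rw [div_eq_inv_mul, mul_smul, ← h4, smul_smul, inv_mul_cancel₀ two_ne_zero, one_smul]

/-- A nonzero closed densely defined operator (given by its graph) from a topologically irreducible
unitary representation that intertwines it with a family of unitary operators is everywhere
defined. -/
theorem exists_mem_graph_of_irreducible {π : G →* (S ≃ₗᵢ[ℂ] S)}
    (hirr : ∀ M : Submodule ℂ S, IsClosed (M : Set S) →
      (∀ g : G, ∀ v ∈ M, π g v ∈ M) → M = ⊥ ∨ M = ⊤)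
    {E : Type*} [NormedAddCommGroup E] [InnerProductSpace ℂ E] [CompleteSpace E]
    (σ : G → E →ₗᵢ[ℂ] E) (hσ : ∀ g F, σ g (σ g⁻¹ F) = F)
    (M : Submodule ℂ (WithLp 2 (S × E))) (hM : IsClosed (M : Set (WithLp 2 (S × E))))
    (hinv : ∀ g s F, WithLp.toLp 2 (s, F) ∈ M → WithLp.toLp 2 (π g s, σ g F) ∈ M)
    (hne : ∃ s F, WithLp.toLp 2 (s, F) ∈ M ∧ s ≠ 0) (s : S) :
    ∃ F, WithLp.toLp 2 (s, F) ∈ M := by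
  have : CompleteSpace M := hM.completeSpace_coe
  -- P P* commutes with π, so it is a scalar c, nonzero because P ≠ 0. Then P (P* (c⁻¹ s)) = s, so P
  -- is onto.
  let P : M →L[ℂ] S := (WithLp.fstL 2 ℂ S E).comp M.subtypeL
  have hP : ∀ m : M, P m = (m : WithLp 2 (S × E)).fst := fun m => rfl
  have hπ : ∀ g s, π g (π g⁻¹ s) = s := fun g s => by
    rw [map_inv]; exact (π g).apply_symm_apply s
  have hadj : ∀ g s, (P.adjoint (π g s) : WithLp 2 (S × E)) =
      WithLp.toLp 2 (π g (P.adjoint s : WithLp 2 (S × E)).fst,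
        σ g (P.adjoint s : WithLp 2 (S × E)).snd) := by
    intro g s
    have hmem := hinv g _ _ (P.adjoint s).2
    suffices h : P.adjoint (π g s) = ⟨_, hmem⟩ from congrArg Subtype.val h
    refine ext_inner_left ℂ fun h => ?_
    rw [ContinuousLinearMap.adjoint_inner_right, hP]
    have hmem' := hinv g⁻¹ _ _ h.2
    have h1 : inner ℂ (⟨_, hmem'⟩ : M) (P.adjoint s) =
        inner ℂ (π g⁻¹ (h : WithLp 2 (S × E)).fst) s := by
      rw [ContinuousLinearMap.adjoint_inner_right, hP]; rfl
    have h2 : inner ℂ (π g⁻¹ (h : WithLp 2 (S × E)).fst) s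
        = inner ℂ (h : WithLp 2 (S × E)).fst (π g s) := by
      rw [← (π g).inner_map_map, hπ]
    rw [← h2, ← h1, Submodule.coe_inner, Submodule.coe_inner, WithLp.prod_inner_apply,
      WithLp.prod_inner_apply]
    congr 1
    · change inner ℂ (π g⁻¹ (h : WithLp 2 (S × E)).fst) _ = inner ℂ _ (π g _)
      conv_lhs => rw [← (π g).inner_map_map, hπ]
      rfl
    · change inner ℂ (σ g⁻¹ (h : WithLp 2 (S × E)).snd) _ = inner ℂ _ (σ g _)
      conv_lhs => rw [← (σ g).inner_map_map, hσ]
      rfl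
  obtain ⟨c, hc⟩ := exists_eq_smul_of_irreducible hirr (A := P.comp P.adjoint) (fun g s => by
    change P (P.adjoint (π g s)) = π g (P (P.adjoint s))
    rw [hP, hadj, hP]; rfl)
  have hc' : ∀ s, P (P.adjoint s) = c • s := hc
  have hc0 : c ≠ 0 := by
    rintro rfl
    obtain ⟨t, F, hm, ht⟩ := hne
    have h0 : P.adjoint t = 0 := by
      rw [← inner_self_eq_zero (𝕜 := ℂ), ContinuousLinearMap.adjoint_inner_left, hc', zero_smul,
        inner_zero_right]
    have : inner ℂ t (P ⟨_, hm⟩) = 0 := by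
      rw [← ContinuousLinearMap.adjoint_inner_left, h0, inner_zero_left]
    exact ht (inner_self_eq_zero.1 this)
  refine ⟨(P.adjoint (c⁻¹ • s) : WithLp 2 (S × E)).snd, ?_⟩
  have h1 : (P.adjoint (c⁻¹ • s) : WithLp 2 (S × E)).fst = s := by
    rw [← hP, hc', smul_smul, mul_inv_cancel₀ hc0, one_smul]
  nth_rewrite 1 [← h1]
  exact (P.adjoint (c⁻¹ • s)).2

end Schur

/-! ### Closed positive forms and their self-adjoint operators. -/

section ClosedForm

variable {S : Type*} [NormedAddCommGroup S] [InnerProductSpace ℂ S]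

/-- The operator `C B⁻¹` for an injective self-adjoint `B`. -/
noncomputable def quotientPMap (B C : S →L[ℂ] S) (hB : Function.Injective B) : S →ₗ.[ℂ] S where
  domain := LinearMap.range B.toLinearMap
  toFun := C.toLinearMap ∘ₗ (LinearEquiv.ofInjective B.toLinearMap hB).symm.toLinearMap

theorem quotientPMap_apply {B C : S →L[ℂ] S} (hB : Function.Injective B) (x : S)
    (h : B x ∈ (quotientPMap B C hB).domain) : quotientPMap B C hB ⟨B x, h⟩ = C x := by
  change C ((LinearEquiv.ofInjective B.toLinearMap hB).symm ⟨B x, h⟩) = C x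
  congr 1
  rw [LinearEquiv.symm_apply_eq]
  rfl

variable [CompleteSpace S]

/-- Symmetry follows from commutation. If y is in the domain of the adjoint, with value z, then B z
= C y, so y = B² y + C² y = B (B y + C z) is already in the range of B. -/
theorem isSelfAdjoint_quotientPMap {B C : S →L[ℂ] S} (hB : Function.Injective B)
    (hBsa : IsSelfAdjoint B) (hCsa : IsSelfAdjoint C) (hBC : ∀ x, B (C x) = C (B x))
    (hsum : ∀ x, B (B x) + C (C x) = x) (hdense : DenseRange B) :
    IsSelfAdjoint (quotientPMap B C hB) := by
  have hBs : ∀ x y, inner ℂ (B x) y = inner ℂ x (B y) := fun x y => by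
    rw [← ContinuousLinearMap.adjoint_inner_right, hBsa.adjoint_eq]
  have hCs : ∀ x y, inner ℂ (C x) y = inner ℂ x (C y) := fun x y => by
    rw [← ContinuousLinearMap.adjoint_inner_right, hCsa.adjoint_eq]
  have hd : Dense ((quotientPMap B C hB).domain : Set S) := hdense
  have hformal : (quotientPMap B C hB).IsFormalAdjoint (quotientPMap B C hB) := by
    rintro ⟨_, x, rfl⟩ ⟨_, y, rfl⟩
    refine (congrArg (inner ℂ · (B y)) (quotientPMap_apply (C := C) hB x ⟨x, rfl⟩)).trans ?_
    refine Eq.trans ?_ (congrArg (inner ℂ (B x)) (quotientPMap_apply (C := C) hB y ⟨y, rfl⟩)).symm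
    rw [hCs, hBs, hBC]
  have hleadj := LinearPMap.IsFormalAdjoint.le_adjoint hd hformal
  rw [LinearPMap.isSelfAdjoint_def]
  symm
  refine LinearPMap.eq_of_le_of_domain_eq hleadj (le_antisymm hleadj.1 fun y hy => ?_)
  let z := (quotientPMap B C hB).adjoint ⟨y, hy⟩
  have hz : B z = C y := by
    refine ext_inner_right ℂ fun x => ?_
    have := LinearPMap.adjoint_isFormalAdjoint hd ⟨y, hy⟩ ⟨B x, x, rfl⟩
    rw [hBs, hCs]
    exact this.trans (congrArg (inner ℂ y) (quotientPMap_apply (C := C) hB x ⟨x, rfl⟩))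
  refine ⟨C z + B y, ?_⟩
  change B (C z + B y) = y
  rw [map_add, hBC, hz, add_comm, hsum]

/-- The representation theorem for closed positive forms: if a Hilbert space `H` is densely and
injectively embedded in `S` by a strictly contractive map `j`, then the form
`⟪u, v⟫ - ⟪j u, j v⟫` on `H` is `⟪K (j u), K (j v)⟫` for a positive self-adjoint operator `K` whose
domain is the range of `j`. -/
theorem exists_isSelfAdjoint_of_embedding {H : Type*} [NormedAddCommGroup H]
    [InnerProductSpace ℂ H] [CompleteSpace H] (j : H →L[ℂ] S) (hinj : Function.Injective j)
    (hdense : DenseRange j) (hlt : ∀ u, u ≠ 0 → ‖j u‖ < ‖u‖) :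
    ∃ K : S →ₗ.[ℂ] S, IsSelfAdjoint K ∧ (∀ f : K.domain, 0 ≤ (inner ℂ (f : S) (K f)).re) ∧
      Function.Injective K ∧ DenseRange K ∧ (∀ f, f ∈ K.domain ↔ f ∈ Set.range j) ∧
      ∀ (f₁ f₂ : K.domain) (u v : H), j u = f₁ → j v = f₂ →
        inner ℂ (K f₁) (K f₂) = inner ℂ u v - inner ℂ (j u) (j v) := by
  have hle : ∀ u, ‖j u‖ ≤ ‖u‖ := fun u => by
    rcases eq_or_ne u 0 with rfl | hu
    · simp
    · exact (hlt u hu).le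
  have hjn : ‖j.adjoint‖ ≤ 1 := by
    rw [LinearIsometryEquiv.norm_map]
    exact j.opNorm_le_bound zero_le_one fun u => by rw [one_mul]; exact hle u
  set A : S →L[ℂ] S := j ∘L j.adjoint with hAdef
  have hApos : 0 ≤ A :=
    (ContinuousLinearMap.nonneg_iff_isPositive A).2 j.isPositive_self_comp_adjoint
  have hAinner : ∀ x, inner ℂ (A x) x = ((‖j.adjoint x‖ ^ 2 : ℝ) : ℂ) := fun x => by
    rw [hAdef, ContinuousLinearMap.comp_apply, ← ContinuousLinearMap.adjoint_inner_right,
      inner_self_eq_norm_sq_to_K]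
    norm_cast
  have hA1pos : 0 ≤ 1 - A := by
    rw [ContinuousLinearMap.nonneg_iff_isPositive]
    refine (ContinuousLinearMap.isPositive_iff_complex _).2 fun x => ?_
    have h1 : inner ℂ ((1 - A) x) x = ((‖x‖ ^ 2 - ‖j.adjoint x‖ ^ 2 : ℝ) : ℂ) := by
      rw [sub_apply, inner_sub_left, hAinner, one_apply_eq_self, inner_self_eq_norm_sq_to_K]
      push_cast
      rfl
    rw [h1]
    refine ⟨rfl, ?_⟩
    have h2 : ‖j.adjoint x‖ ≤ ‖x‖ := (j.adjoint.le_of_opNorm_le hjn x).trans_eq (one_mul _)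
    have h3 := pow_le_pow_left₀ (norm_nonneg _) h2 2
    exact sub_nonneg.2 h3
  -- The operator will be K = C B⁻¹, since ‖C x‖² = ‖x‖² - ‖B x‖² by B² + C² = 1.
  set B : S →L[ℂ] S := CFC.sqrt A with hBdef
  set C : S →L[ℂ] S := CFC.sqrt (1 - A) with hCdef
  have hBpos : 0 ≤ B := CFC.sqrt_nonneg A
  have hCpos : 0 ≤ C := CFC.sqrt_nonneg _
  have hBsa : IsSelfAdjoint B := hBpos.isSelfAdjoint
  have hCsa : IsSelfAdjoint C := hCpos.isSelfAdjoint
  have hBB : B * B = A := CFC.sqrt_mul_sqrt_self A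
  have hCC : C * C = 1 - A := CFC.sqrt_mul_sqrt_self (1 - A)
  have hcomm : Commute B C := by
    have h1 : Commute A (1 - A) := (Commute.one_right A).sub_right (Commute.refl A)
    exact ((h1.cfcₙ_nnreal NNReal.sqrt).symm.cfcₙ_nnreal NNReal.sqrt).symm
  have hBC : ∀ x, B (C x) = C (B x) := fun x => congrArg (fun T : S →L[ℂ] S => T x) hcomm.eq
  have hBBx : ∀ x, B (B x) = A x := fun x => congrArg (fun T : S →L[ℂ] S => T x) hBB
  have hCCx : ∀ x, C (C x) = x - A x := fun x => congrArg (fun T : S →L[ℂ] S => T x) hCC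
  have hsum : ∀ x, B (B x) + C (C x) = x := fun x => by rw [hBBx, hCCx]; abel
  have hBs : ∀ x y, inner ℂ (B x) y = inner ℂ x (B y) := fun x y => by
    rw [← ContinuousLinearMap.adjoint_inner_right, hBsa.adjoint_eq]
  have hCs : ∀ x y, inner ℂ (C x) y = inner ℂ x (C y) := fun x y => by
    rw [← ContinuousLinearMap.adjoint_inner_right, hCsa.adjoint_eq]
  have hnorm : ∀ x, ‖j.adjoint x‖ = ‖B x‖ := fun x => by
    have h1 : ((‖B x‖ ^ 2 : ℝ) : ℂ) = ((‖j.adjoint x‖ ^ 2 : ℝ) : ℂ) := by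
      rw [← hAinner, ← hBBx, hBs, inner_self_eq_norm_sq_to_K]
      norm_cast
    exact ((pow_left_inj₀ (norm_nonneg _) (norm_nonneg _) two_ne_zero).1
      (Complex.ofReal_injective h1)).symm
  have hjadj : Function.Injective j.adjoint := by
    rw [injective_iff_map_eq_zero]
    intro x hx
    refine hdense.eq_zero_of_inner_left ℂ ?_
    rintro u
    rw [← ContinuousLinearMap.adjoint_inner_left, hx, inner_zero_left]
  have hBinj : Function.Injective B := by
    rw [injective_iff_map_eq_zero]
    intro x hx
    apply hjadj
    rw [map_zero, ← norm_eq_zero, hnorm, hx, norm_zero]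
  have dense_of_inj : ∀ T : S →L[ℂ] S, (∀ x y, inner ℂ (T x) y = inner ℂ x (T y)) →
      Function.Injective T → DenseRange T := by
    intro T hT hTi
    have : Dense ((LinearMap.range T.toLinearMap : Submodule ℂ S) : Set S) := by
      rw [Submodule.dense_iff_topologicalClosure_eq_top, Submodule.topologicalClosure_eq_top_iff,
        Submodule.eq_bot_iff]
      intro x hx
      apply hTi
      rw [map_zero, ← inner_self_eq_zero (𝕜 := ℂ), hT]
      exact (Submodule.mem_orthogonal' _ _).1 hx _ ⟨_, rfl⟩
    exact this
  have hBdense : DenseRange B := dense_of_inj B hBs hBinj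
  -- Polar decomposition j* = R B. The isometry R gives B = j R and j = B R*, so j and B have the
  -- same range, and B x = j u forces u = R x.
  let R : S →L[ℂ] H := j.adjoint.toLinearMap.extendOfNorm B.toLinearMap
  have hRB : ∀ x, R (B x) = j.adjoint x := fun x =>
    LinearMap.extendOfNorm_eq (f := j.adjoint.toLinearMap) (e := B.toLinearMap) hBdense
      ⟨1, fun y => by rw [one_mul]; exact (hnorm y).le⟩ x
  have hRnorm : ∀ x, ‖R x‖ = ‖x‖ := fun x =>
    hBdense.induction_on (p := fun x => ‖R x‖ = ‖x‖) x
      (isClosed_eq R.continuous.norm continuous_norm) (fun y => by rw [hRB, hnorm])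
  let Ri : S →ₗᵢ[ℂ] H := ⟨R.toLinearMap, hRnorm⟩
  have hjR : ∀ u, j u = B (R.adjoint u) := by
    intro u
    refine ext_inner_left ℂ fun x => ?_
    rw [← hBs, ContinuousLinearMap.adjoint_inner_right, hRB,
      ContinuousLinearMap.adjoint_inner_left]
  have hBR : ∀ x, B x = j (R x) := by
    intro x
    rw [hjR]
    congr 1
    refine ext_inner_left ℂ fun y => ?_
    rw [ContinuousLinearMap.adjoint_inner_right]
    exact (Ri.inner_map_map y x).symm
  have hform : ∀ (f₁ f₂ : (quotientPMap B C hBinj).domain) (u v : H), j u = f₁ → j v = f₂ →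
      inner ℂ (quotientPMap B C hBinj f₁) (quotientPMap B C hBinj f₂)
        = inner ℂ u v - inner ℂ (j u) (j v) := by
    rintro ⟨_, x, rfl⟩ ⟨_, y, rfl⟩ u v hu hv
    have hu' : j u = B x := hu
    have hv' : j v = B y := hv
    have hux : u = R x := hinj (hu'.trans (hBR x))
    have hvy : v = R y := hinj (hv'.trans (hBR y))
    have h1 := quotientPMap_apply (C := C) hBinj x ⟨x, rfl⟩
    have h2 := quotientPMap_apply (C := C) hBinj y ⟨y, rfl⟩
    refine (congrArg₂ (inner ℂ) h1 h2).trans ?_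
    rw [hu', hv', hCs, hCCx, inner_sub_right, hBs, hBBx, hux, hvy]
    congr 1
    exact (Ri.inner_map_map x y).symm
  -- Here the strict contraction enters: K (j u) = 0 means ‖u‖ = ‖j u‖.
  have hKinj : Function.Injective (quotientPMap B C hBinj) := by
    rw [show ⇑(quotientPMap B C hBinj) = ⇑(quotientPMap B C hBinj).toFun from rfl,
      injective_iff_map_eq_zero]
    rintro ⟨_, x, rfl⟩ hx
    have h1 := hform ⟨_, x, rfl⟩ ⟨_, x, rfl⟩ (R x) (R x) (hBR x).symm (hBR x).symm
    have hx' : quotientPMap B C hBinj ⟨B x, x, rfl⟩ = 0 := hx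
    have h2 : R x = 0 := by
      by_contra hne
      have h3 : inner ℂ (R x) (R x) = inner ℂ (j (R x)) (j (R x)) := by
        rw [← sub_eq_zero, ← h1]
        exact (congrArg₂ (inner ℂ) hx' hx').trans (inner_zero_left _)
      rw [inner_self_eq_norm_sq_to_K, inner_self_eq_norm_sq_to_K] at h3
      norm_cast at h3
      exact (hlt _ hne).ne' ((pow_left_inj₀ (norm_nonneg _) (norm_nonneg _) two_ne_zero).1 h3)
    refine Subtype.ext ?_
    change B x = 0
    rw [hBR, h2, map_zero]
  refine ⟨quotientPMap B C hBinj, isSelfAdjoint_quotientPMap hBinj hBsa hCsa hBC hsum hBdense,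
    ?_, hKinj, ?_, ?_, hform⟩
  · rintro ⟨_, x, rfl⟩
    have h1 := quotientPMap_apply (C := C) hBinj x ⟨x, rfl⟩
    have h2 : 0 ≤ B * C := hcomm.mul_nonneg hBpos hCpos
    have h3 := ((ContinuousLinearMap.nonneg_iff_isPositive _).1 h2).re_inner_nonneg_right x
    refine h3.trans_eq ?_
    refine (congrArg Complex.re ?_)
    refine Eq.trans ?_ (congrArg (inner ℂ (B x)) h1).symm
    rw [hBs]
    rfl
  · have hCinj : Function.Injective C := by
      rw [injective_iff_map_eq_zero]
      intro x hx
      have h1 := quotientPMap_apply (C := C) hBinj x ⟨x, rfl⟩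
      have h2 := hKinj (h1.trans (hx.trans (LinearPMap.map_zero _).symm))
      exact hBinj ((congrArg Subtype.val h2).trans (map_zero B).symm)
    refine (dense_of_inj C hCs hCinj).mono ?_
    rintro _ ⟨x, rfl⟩
    exact ⟨⟨B x, x, rfl⟩, quotientPMap_apply hBinj x _⟩
  · intro f
    constructor
    · rintro ⟨x, rfl⟩
      exact ⟨R x, (hBR x).symm⟩
    · rintro ⟨u, rfl⟩
      exact ⟨R.adjoint u, (hjR u).symm⟩

end ClosedForm

/-! ### Closed graphs in S ⊕ L². -/

section FunctionalGraph

variable {G : Type*} [MeasurableSpace G] {μ : Measure G} {S : Type*} [NormedAddCommGroup S]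
  [InnerProductSpace ℂ S]

/-- An L²-convergent sequence has a subsequence converging almost everywhere, whose limit must be
the pointwise one. This is what closes the graphs below. -/
theorem MeasureTheory.Lp.coeFn_ae_eq_of_tendsto {F : ℕ → Lp ℂ 2 μ} {F₀ : Lp ℂ 2 μ}
    (hF : Filter.Tendsto F Filter.atTop (nhds F₀)) {a : ℕ → G → ℂ} {a₀ : G → ℂ}
    (ha : ∀ n, F n =ᵐ[μ] a n)
    (hlim : ∀ x, Filter.Tendsto (fun n => a n x) Filter.atTop (nhds (a₀ x))) :
    F₀ =ᵐ[μ] a₀ := by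
  obtain ⟨ns, hns, h⟩ := (tendstoInMeasure_of_tendsto_Lp hF).exists_seq_tendsto_ae
  filter_upwards [h, ae_all_iff.2 ha] with x hx hax
  refine tendsto_nhds_unique hx ?_
  simp only [hax]
  exact (hlim x).comp hns.tendsto_atTop

variable (μ) in
/-- The graph of the operator `s ↦ (g ↦ ℓ g s)` from `S` to `L²(μ)`. -/
def functionalGraph (ℓ : G → S →L[ℂ] ℂ) : Submodule ℂ (WithLp 2 (S × Lp ℂ 2 μ)) where
  carrier := {p | p.snd =ᵐ[μ] fun g => ℓ g p.fst}
  add_mem' {p q} hp hq := by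
    change ((p.snd + q.snd : Lp ℂ 2 μ) : G → ℂ) =ᵐ[μ] fun g => ℓ g (p.fst + q.fst)
    filter_upwards [hp, hq, Lp.coeFn_add p.snd q.snd] with g h1 h2 h3
    rw [h3, Pi.add_apply, h1, h2, map_add]
  zero_mem' := by
    change ((0 : Lp ℂ 2 μ) : G → ℂ) =ᵐ[μ] fun g => ℓ g 0
    filter_upwards [Lp.coeFn_zero ℂ 2 μ] with g h
    rw [h, map_zero, Pi.zero_apply]
  smul_mem' c p hp := by
    change ((c • p.snd : Lp ℂ 2 μ) : G → ℂ) =ᵐ[μ] fun g => ℓ g (c • p.fst)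
    filter_upwards [hp, Lp.coeFn_smul c p.snd] with g h1 h3
    rw [h3, Pi.smul_apply, h1, map_smul]

theorem mem_functionalGraph {ℓ : G → S →L[ℂ] ℂ} {p : WithLp 2 (S × Lp ℂ 2 μ)} :
    p ∈ functionalGraph μ ℓ ↔ p.snd =ᵐ[μ] fun g => ℓ g p.fst := Iff.rfl

theorem isClosed_functionalGraph (ℓ : G → S →L[ℂ] ℂ) :
    IsClosed (functionalGraph μ ℓ : Set (WithLp 2 (S × Lp ℂ 2 μ))) := by
  refine IsSeqClosed.isClosed fun p q hp hq => ?_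
  have h1 := ((WithLp.sndL 2 ℂ S (Lp ℂ 2 μ)).continuous.tendsto q).comp hq
  have h2 := ((WithLp.fstL 2 ℂ S (Lp ℂ 2 μ)).continuous.tendsto q).comp hq
  exact Lp.coeFn_ae_eq_of_tendsto h1 (fun n => mem_functionalGraph.1 (hp n))
    fun x => ((ℓ x).continuous.tendsto _).comp h2

end FunctionalGraph

/-! ### Wavelet transforms, orthogonality and the Duflo–Moore operator. -/

section WaveletTransform

variable {G : Type*} [Group G] {S : Type*} [NormedAddCommGroup S] [InnerProductSpace ℂ S]

theorem rep_apply_rep_inv (π : G →* (S ≃ₗᵢ[ℂ] S)) (g : G) (s : S) : π g (π g⁻¹ s) = s := by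
  rw [map_inv]; exact (π g).apply_symm_apply s

theorem rep_inv_apply_rep (π : G →* (S ≃ₗᵢ[ℂ] S)) (g : G) (s : S) : π g⁻¹ (π g s) = s := by
  rw [map_inv]; exact (π g).symm_apply_apply s

theorem waveletTransform_rep (π : G →* (S ≃ₗᵢ[ℂ] S)) (f s : S) (h g : G) :
    waveletTransform π f (π h s) g = waveletTransform π f s (h⁻¹ * g) := by
  unfold waveletTransform
  rw [map_mul, ← (π h).inner_map_map ((π h⁻¹ * π g) f)]
  congr 1
  exact (rep_apply_rep_inv π h _).symm

theorem waveletTransform_rep_window (π : G →* (S ≃ₗᵢ[ℂ] S)) (f s : S) (h g : G) :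
    waveletTransform π (π h f) s g = waveletTransform π f s (g * h) := by
  unfold waveletTransform
  rw [map_mul]; rfl

theorem conj_waveletTransform (π : G →* (S ≃ₗᵢ[ℂ] S)) (f s : S) (g : G) :
    conj (waveletTransform π f s g) = inner ℂ s (π g f) := inner_conj_symm _ _

/-- The vectors with vanishing transform form a closed invariant subspace. If it is nonzero it
contains f, and V_f[f](1) = ‖f‖². -/
theorem eq_zero_of_waveletTransform_eq_zero {π : G →* (S ≃ₗᵢ[ℂ] S)}
    (hirr : ∀ M : Submodule ℂ S, IsClosed (M : Set S) →
      (∀ g : G, ∀ v ∈ M, π g v ∈ M) → M = ⊥ ∨ M = ⊤)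
    {f s : S} (hs : s ≠ 0) (h : ∀ g, waveletTransform π f s g = 0) : f = 0 := by
  let M : Submodule ℂ S := ⨅ g : G, LinearMap.ker (innerSL ℂ (π g f)).toLinearMap
  have hM : ∀ v, v ∈ M ↔ ∀ g, waveletTransform π f v g = 0 := fun v => by
    simp only [M, Submodule.mem_iInf]; rfl
  rcases hirr M (by
      rw [Submodule.coe_iInf]
      exact isClosed_iInter fun g => (innerSL ℂ (π g f)).isClosed_ker)
    (fun g v hv => by
      rw [hM] at hv ⊢
      intro x
      rw [waveletTransform_rep, hv]) with hb | ht
  · exact absurd ((Submodule.mem_bot ℂ).1 (hb ▸ (hM s).2 h)) hs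
  · have h1 := (hM f).1 (ht ▸ Submodule.mem_top) 1
    unfold waveletTransform at h1
    rw [map_one] at h1
    exact inner_self_eq_zero.1 h1

variable [TopologicalSpace G]

theorem IsSquareIntegrableRep.continuous_waveletTransform [MeasurableSpace G] {μ : Measure G}
    {π : G →* (S ≃ₗᵢ[ℂ] S)} (hπ : IsSquareIntegrableRep π μ) (f s : S) :
    Continuous (waveletTransform π f s) :=
  (hπ.continuous f).inner continuous_const

variable [IsTopologicalGroup G] [MeasurableSpace G] [BorelSpace G] {μ : Measure G}
  [μ.IsHaarMeasure] [CompleteSpace S] {π : G →* (S ≃ₗᵢ[ℂ] S)}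

/-- If `V_f[s₀]` is square integrable for one nonzero `s₀` then so is `V_f[s]` for every `s`. -/
theorem IsSquareIntegrableRep.memLp_of_ne_zero (hπ : IsSquareIntegrableRep π μ) {f s₀ : S}
    (hs₀ : s₀ ≠ 0) (h : MemLp (waveletTransform π f s₀) 2 μ) (s : S) :
    MemLp (waveletTransform π f s) 2 μ := by
  have hmp : ∀ g : G, MeasurePreserving (g⁻¹ * ·) μ μ := fun g => measurePreserving_mul_left μ g⁻¹
  let σ : G → Lp ℂ 2 μ →ₗᵢ[ℂ] Lp ℂ 2 μ := fun g =>
    Lp.compMeasurePreservingₗᵢ ℂ (g⁻¹ * ·) (hmp g)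
  have hσ_coe : ∀ g F, σ g F =ᵐ[μ] fun x => F (g⁻¹ * x) := fun g F =>
    Lp.coeFn_compMeasurePreserving F (hmp g)
  obtain ⟨F, hF⟩ := exists_mem_graph_of_irreducible hπ.irreducible σ (fun g F => by
      refine Lp.ext ?_
      refine (hσ_coe g _).trans ?_
      refine ((hmp g).quasiMeasurePreserving.ae_eq_comp (hσ_coe g⁻¹ F)).trans ?_
      refine Filter.Eventually.of_forall fun x => ?_
      simp)
    (functionalGraph μ fun g => innerSL ℂ (π g f)) (isClosed_functionalGraph _)
    (fun g t F hF => by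
      rw [mem_functionalGraph] at hF ⊢
      refine (hσ_coe g F).trans ?_
      refine ((hmp g).quasiMeasurePreserving.ae_eq_comp hF).trans ?_
      exact Filter.Eventually.of_forall fun x => (waveletTransform_rep π f t g x).symm)
    ⟨s₀, h.toLp _, h.coeFn_toLp, hs₀⟩ s
  exact (memLp_congr_ae (mem_functionalGraph.1 hF)).1 (Lp.memLp F)

theorem IsSquareIntegrableRep.memLp_waveletTransform (hπ : IsSquareIntegrableRep π μ) {f : S}
    (hf : IsWindow π μ f) (s : S) : MemLp (waveletTransform π f s) 2 μ := by
  rcases eq_or_ne f 0 with rfl | hf0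
  · have : waveletTransform π (0 : S) s = 0 := by
      ext g; simp [waveletTransform]
    rw [this]
    exact MemLp.zero
  · exact hπ.memLp_of_ne_zero hf0 hf s

/-- The subspace of windows. -/
def IsSquareIntegrableRep.windows (hπ : IsSquareIntegrableRep π μ) : Submodule ℂ S where
  carrier := {f | IsWindow π μ f}
  add_mem' {f₁ f₂} h₁ h₂ := by
    have : waveletTransform π (f₁ + f₂) (f₁ + f₂)
        = waveletTransform π f₁ (f₁ + f₂) + waveletTransform π f₂ (f₁ + f₂) := by
      ext g; simp only [waveletTransform, map_add, inner_add_left, Pi.add_apply]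
    change MemLp _ 2 μ
    rw [this]
    exact (hπ.memLp_waveletTransform h₁ _).add (hπ.memLp_waveletTransform h₂ _)
  zero_mem' := by
    have : waveletTransform π (0 : S) 0 = 0 := by
      ext g; simp [waveletTransform]
    change MemLp _ 2 μ
    rw [this]
    exact MemLp.zero
  smul_mem' c f h := by
    have : waveletTransform π (c • f) (c • f) = conj c • waveletTransform π f (c • f) := by
      ext g; simp only [waveletTransform, map_smul, inner_smul_left, Pi.smul_apply, smul_eq_mul]
    change MemLp _ 2 μ
    rw [this]
    exact (hπ.memLp_waveletTransform h _).const_smul _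

theorem IsSquareIntegrableRep.isWindow_rep [LocallyCompactSpace G] [μ.Regular]
    (hπ : IsSquareIntegrableRep π μ) {f : S} (hf : IsWindow π μ f) (h : G) :
    IsWindow π μ (π h f) := by
  have h1 : waveletTransform π (π h f) (π h f) = waveletTransform π f (π h f) ∘ (· * h) := by
    ext g; exact waveletTransform_rep_window π f _ h g
  unfold IsWindow
  rw [h1]
  have hreg : (Measure.map (· * h) μ).Regular := Measure.Regular.map (Homeomorph.mulRight h)
  refine MemLp.comp_of_map ?_ (measurable_mul_const h).aemeasurable
  -- Right translation turns μ into another left Haar measure, a finite multiple of μ by uniqueness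
  -- (the modular function).
  rw [Measure.isMulLeftInvariant_eq_smul_of_regular (Measure.map (· * h) μ) μ]
  exact (hπ.memLp_waveletTransform hf _).smul_measure ENNReal.coe_ne_top

theorem IsSquareIntegrableRep.dense_windows [LocallyCompactSpace G] [μ.Regular]
    (hπ : IsSquareIntegrableRep π μ) : Dense (hπ.windows : Set S) := by
  rw [Submodule.dense_iff_topologicalClosure_eq_top]
  refine (hπ.irreducible hπ.windows.topologicalClosure
    hπ.windows.isClosed_topologicalClosure fun g v hv => ?_).resolve_left fun hb => ?_
  · exact map_mem_closure (π g).continuous hv fun w hw => hπ.isWindow_rep hw g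
  · obtain ⟨f, hf0, hf⟩ := hπ.exists_window
    exact hf0 ((Submodule.mem_bot ℂ).1 (hb ▸ hπ.windows.le_topologicalClosure hf))

/-- The wavelet transform with a fixed window as a bounded operator from `S` to `L²(G)`. -/
noncomputable def IsSquareIntegrableRep.waveletLp (hπ : IsSquareIntegrableRep π μ) {f : S}
    (hf : IsWindow π μ f) : S →L[ℂ] Lp ℂ 2 μ :=
  ContinuousLinearMap.ofSeqClosedGraph
    (g :=
    { toFun s := (hπ.memLp_waveletTransform hf s).toLp _
      map_add' s t := by
        rw [← MemLp.toLp_add]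
        congr 1
        ext g; exact inner_add_right _ _ _
      map_smul' c s := by
        rw [RingHom.id_apply, ← MemLp.toLp_const_smul]
        congr 1
        ext g; exact inner_smul_right _ _ _ })
    (fun u x y hu hy => by
      refine Lp.ext ((Lp.coeFn_ae_eq_of_tendsto hy (fun n =>
        MemLp.coeFn_toLp (hπ.memLp_waveletTransform hf (u n))) fun g => ?_).trans
        (MemLp.coeFn_toLp (hπ.memLp_waveletTransform hf x)).symm)
      exact tendsto_const_nhds.inner hu)

theorem IsSquareIntegrableRep.coeFn_waveletLp (hπ : IsSquareIntegrableRep π μ) {f : S}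
    (hf : IsWindow π μ f) (s : S) : hπ.waveletLp hf s =ᵐ[μ] waveletTransform π f s :=
  MemLp.coeFn_toLp (hπ.memLp_waveletTransform hf s)

theorem IsSquareIntegrableRep.inner_waveletLp (hπ : IsSquareIntegrableRep π μ) {f₁ f₂ : S}
    (hf₁ : IsWindow π μ f₁) (hf₂ : IsWindow π μ f₂) (s₁ s₂ : S) :
    inner ℂ (hπ.waveletLp hf₂ s₂) (hπ.waveletLp hf₁ s₁) =
      ∫ g, waveletTransform π f₁ s₁ g * conj (waveletTransform π f₂ s₂ g) ∂μ := by
  rw [L2.inner_def]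
  refine integral_congr_ae ?_
  filter_upwards [hπ.coeFn_waveletLp hf₁ s₁, hπ.coeFn_waveletLp hf₂ s₂] with g h1 h2
  rw [h1, h2, RCLike.inner_apply]

/-- V_{f₂}* V_{f₁} commutes with π by left invariance of μ, so Schur's lemma makes it the scalar c.
-/
theorem IsSquareIntegrableRep.exists_orthogonality (hπ : IsSquareIntegrableRep π μ) {f₁ f₂ : S}
    (hf₁ : IsWindow π μ f₁) (hf₂ : IsWindow π μ f₂) : ∃ c : ℂ, ∀ s₁ s₂ : S,
    ∫ g, waveletTransform π f₁ s₁ g * conj (waveletTransform π f₂ s₂ g) ∂μ =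
      inner ℂ s₂ s₁ * c := by
  obtain ⟨c, hc⟩ := exists_eq_smul_of_irreducible hπ.irreducible
    (A := (hπ.waveletLp hf₂).adjoint.comp (hπ.waveletLp hf₁)) (fun g s => by
      refine ext_inner_left ℂ fun v => ?_
      rw [← (π g⁻¹).inner_map_map v (π g _), rep_inv_apply_rep, ContinuousLinearMap.comp_apply,
        ContinuousLinearMap.comp_apply, ContinuousLinearMap.adjoint_inner_right,
        ContinuousLinearMap.adjoint_inner_right, hπ.inner_waveletLp, hπ.inner_waveletLp]
      simp only [waveletTransform_rep, inv_inv]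
      rw [← integral_mul_left_eq_self _ g]
      simp only [inv_mul_cancel_left])
  refine ⟨c, fun s₁ s₂ => ?_⟩
  rw [← hπ.inner_waveletLp hf₁ hf₂, ← ContinuousLinearMap.adjoint_inner_right, mul_comm,
    ← inner_smul_right, ← hc]
  rfl

/-- Existence of the Duflo–Moore operator. -/
theorem IsSquareIntegrableRep.exists_isDufloMoore [LocallyCompactSpace G] [μ.Regular]
    (hπ : IsSquareIntegrableRep π μ) : ∃ K : S →ₗ.[ℂ] S, IsDufloMoore π μ K := by
  obtain ⟨s₀, hs₀⟩ : ∃ s₀ : S, ‖s₀‖ = 1 := by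
    obtain ⟨f, hf0, -⟩ := hπ.exists_window
    have : Nontrivial S := ⟨f, 0, hf0⟩
    exact exists_norm_eq S zero_le_one
  have hs₀0 : s₀ ≠ 0 := by
    rintro rfl
    simp at hs₀
  -- The conjugate of V_f[s₀](g), chosen because it is linear in f. On its graph H the norm is ‖f‖²
  -- + ‖V_f[s₀]‖², squared, and the projection j to S has range the windows.
  let ℓ : G → S →L[ℂ] ℂ := fun g =>
    (innerSL ℂ s₀).comp ((π g).toContinuousLinearEquiv : S →L[ℂ] S)
  have hℓ : ∀ f g, ℓ g f = conj (waveletTransform π f s₀ g) := fun f g =>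
    (conj_waveletTransform π f s₀ g).symm
  have hgraph : ∀ p : WithLp 2 (S × Lp ℂ 2 μ), p ∈ functionalGraph μ ℓ ↔
      p.snd =ᵐ[μ] fun g => conj (waveletTransform π p.fst s₀ g) := fun p => by
    rw [mem_functionalGraph]
    simp only [hℓ]
  let H := functionalGraph μ ℓ
  have : CompleteSpace H := (isClosed_functionalGraph ℓ).completeSpace_coe
  let j : H →L[ℂ] S := (WithLp.fstL 2 ℂ S (Lp ℂ 2 μ)).comp H.subtypeL
  have hj : ∀ u : H, j u = (u : WithLp 2 (S × Lp ℂ 2 μ)).fst := fun u => rfl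
  have hnorm : ∀ u : H, ‖u‖ ^ 2 = ‖j u‖ ^ 2 + ‖(u : WithLp 2 (S × Lp ℂ 2 μ)).snd‖ ^ 2 := fun u =>
    WithLp.prod_norm_sq_eq_of_L2 _
  have hsnd : ∀ u : H, (u : WithLp 2 (S × Lp ℂ 2 μ)).snd = 0 → j u = 0 := by
    intro u hu
    refine eq_zero_of_waveletTransform_eq_zero hπ.irreducible hs₀0 ?_
    have h1 := (hgraph u).1 u.2
    have h2 : (fun g => conj (waveletTransform π (j u) s₀ g)) =ᵐ[μ] fun _ => 0 := by
      rw [hu] at h1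
      exact h1.symm.trans (Lp.coeFn_zero ℂ 2 μ)
    -- Haar measure charges nonempty open sets, so a continuous function null almost everywhere is
    -- null.
    have h3 := Continuous.ae_eq_iff_eq μ
      (Complex.continuous_conj.comp (hπ.continuous_waveletTransform (j u) s₀)) continuous_const
      |>.1 h2
    intro g
    exact (map_eq_zero _).1 (congrFun h3 g)
  have hjinj : Function.Injective j := by
    rw [injective_iff_map_eq_zero]
    intro u hu
    have h1 := (hgraph u).1 u.2
    rw [← hj, hu] at h1
    have h2 : (u : WithLp 2 (S × Lp ℂ 2 μ)).snd = 0 := by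
      refine Lp.ext (h1.trans (Filter.EventuallyEq.trans ?_ (Lp.coeFn_zero ℂ 2 μ).symm))
      exact Filter.Eventually.of_forall fun g => by simp [waveletTransform]
    have h3 := hnorm u
    rw [hu, h2] at h3
    simpa using h3
  have hrange : ∀ f, f ∈ Set.range j ↔ IsWindow π μ f := by
    intro f
    constructor
    · rintro ⟨u, rfl⟩
      have h1 := (memLp_congr_ae ((hgraph u).1 u.2)).1 (Lp.memLp _)
      have h2 := h1.star
      refine hπ.memLp_of_ne_zero hs₀0 ?_ _
      convert h2 using 1
      ext g
      exact (Complex.conj_conj _).symm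
    · intro hf
      have h1 := (hπ.memLp_waveletTransform hf s₀).star
      exact ⟨⟨WithLp.toLp 2 (f, h1.toLp _), (hgraph _).2 h1.coeFn_toLp⟩, rfl⟩
  have hjdense : DenseRange j := by
    refine hπ.dense_windows.mono fun f hf => ?_
    exact (hrange f).2 hf
  obtain ⟨K, hKsa, hKpos, hKinj, hKrange, hKdom, hKform⟩ :=
    exists_isSelfAdjoint_of_embedding j hjinj hjdense (fun u hu => by
      refine lt_of_pow_lt_pow_left₀ 2 (norm_nonneg _) ?_
      rw [hnorm u]
      have h1 : (u : WithLp 2 (S × Lp ℂ 2 μ)).snd ≠ 0 := fun h =>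
        hu (hjinj ((hsnd u h).trans (map_zero j).symm))
      have h2 := norm_pos_iff.2 h1
      exact lt_add_of_pos_right _ (pow_pos h2 2))
  refine ⟨K, hKsa, hKpos, hKinj, hKrange, fun f => (hKdom f).trans (hrange f), ?_⟩
  intro f₁ f₂ s₁ s₂
  obtain ⟨u, hu⟩ := (hKdom f₁).1 f₁.2
  obtain ⟨v, hv⟩ := (hKdom f₂).1 f₂.2
  obtain ⟨c, hc⟩ := hπ.exists_orthogonality ((hrange f₁).1 ⟨u, hu⟩) ((hrange f₂).1 ⟨v, hv⟩)
  rw [hc, hKform f₁ f₂ u v hu hv]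
  congr 1
  have h1 : inner ℂ u v - inner ℂ (j u) (j v) =
      inner ℂ (u : WithLp 2 (S × Lp ℂ 2 μ)).snd (v : WithLp 2 (S × Lp ℂ 2 μ)).snd := by
    rw [Submodule.coe_inner, WithLp.prod_inner_apply]
    exact add_sub_cancel_left _ _
  -- As ‖s₀‖ = 1, the scalar c is the pairing at s₀, which is the form defining K.
  have h2 := hc s₀ s₀
  rw [inner_self_eq_norm_sq_to_K, hs₀] at h2
  rw [h1, L2.inner_def]
  have h3 : c = ∫ g, waveletTransform π (f₁ : S) s₀ g *
      conj (waveletTransform π (f₂ : S) s₀ g) ∂μ := by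
    rw [h2]; simp
  rw [h3]
  refine integral_congr_ae ?_
  filter_upwards [(hgraph u).1 u.2, (hgraph v).1 v.2] with g hg₁ hg₂
  rw [hg₁, hg₂, RCLike.inner_apply, Complex.conj_conj, ← hj, ← hj, hu, hv, mul_comm]

end WaveletTransform

/-! ### The Hilbert tensor product. -/

section Tensor

variable {ι κ : Type*} {W S : Type*} [NormedAddCommGroup W] [InnerProductSpace ℂ W]
  [NormedAddCommGroup S] [InnerProductSpace ℂ S]

theorem lp.norm_sq_eq_tsum_sq {α : Type*} (x : lp (fun _ : α => ℂ) 2) :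
    ‖x‖ ^ 2 = ∑' i, ‖x i‖ ^ 2 := by
  simpa using lp.norm_rpow_eq_tsum (by norm_num) x

theorem lp.summable_norm_sq {α : Type*} (x : lp (fun _ : α => ℂ) 2) :
    Summable fun i => ‖x i‖ ^ 2 := by
  simpa using (lp.memℓp x).summable (by norm_num)

theorem norm_simpleTensor (φ : HilbertBasis ι ℂ W) (η : HilbertBasis κ ℂ S) (f : W) (s : S) :
    ‖simpleTensor φ η f s‖ = ‖f‖ * ‖s‖ := by
  rw [← φ.repr.norm_map f, ← η.repr.norm_map s]
  refine (pow_left_inj₀ (norm_nonneg _) (by positivity) two_ne_zero).1 ?_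
  rw [mul_pow, lp.norm_sq_eq_tsum_sq, lp.norm_sq_eq_tsum_sq, lp.norm_sq_eq_tsum_sq,
    tsum_mul_tsum_of_summable_norm (lp.summable_norm_sq (φ.repr f)).norm
      (lp.summable_norm_sq (η.repr s)).norm]
  refine tsum_congr fun p => ?_
  change ‖conj (φ.repr f p.1) * η.repr s p.2‖ ^ 2 = _
  rw [norm_mul, RCLike.norm_conj, mul_pow]

theorem simpleTensor_sub_left (φ : HilbertBasis ι ℂ W) (η : HilbertBasis κ ℂ S) (f₁ f₂ : W)
    (s : S) :
    simpleTensor φ η (f₁ - f₂) s = simpleTensor φ η f₁ s - simpleTensor φ η f₂ s := by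
  ext p
  change conj (φ.repr (f₁ - f₂) p.1) * η.repr s p.2 =
    conj (φ.repr f₁ p.1) * η.repr s p.2 - conj (φ.repr f₂ p.1) * η.repr s p.2
  rw [map_sub, lp.coeFn_sub, Pi.sub_apply, map_sub, sub_mul]

theorem continuous_simpleTensor_left (φ : HilbertBasis ι ℂ W) (η : HilbertBasis κ ℂ S) (s : S) :
    Continuous fun f => simpleTensor φ η f s := by
  refine (LipschitzWith.of_dist_le_mul (K := ‖s‖₊) fun f₁ f₂ => ?_).continuous
  rw [dist_eq_norm, dist_eq_norm, ← simpleTensor_sub_left, norm_simpleTensor, mul_comm]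
  rfl

theorem simpleTensor_basis [DecidableEq (ι × κ)] (φ : HilbertBasis ι ℂ W)
    (η : HilbertBasis κ ℂ S) (p : ι × κ) :
    simpleTensor φ η (φ p.1) (η p.2) = lp.single 2 p (1 : ℂ) := by
  classical
  ext q
  change conj (φ.repr (φ p.1) q.1) * η.repr (η p.2) q.2 = _
  rw [φ.repr_self, η.repr_self, lp.single_apply, lp.single_apply, lp.single_apply]
  rcases p with ⟨n, m⟩
  rcases q with ⟨n', m'⟩
  by_cases h1 : n' = n
  · subst h1
    by_cases h2 : m' = m
    · subst h2
      simp
    · simp [h2]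
  · simp [Pi.single_apply, h1]

theorem TensorSpace.clm_ext {E : Type*} [NormedAddCommGroup E] [NormedSpace ℂ E]
    (φ : HilbertBasis ι ℂ W) (η : HilbertBasis κ ℂ S) {T T' : TensorSpace φ η →L[ℂ] E}
    (h : ∀ p : ι × κ, T (simpleTensor φ η (φ p.1) (η p.2)) =
      T' (simpleTensor φ η (φ p.1) (η p.2))) : T = T' := by
  classical
  ext x
  have hx := lp.hasSum_single (E := fun _ : ι × κ => ℂ) (p := 2) (by norm_num) x
  have key : ∀ p, T (lp.single 2 p (x p)) = T' (lp.single 2 p (x p)) := fun p => by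
    have h1 : lp.single (E := fun _ : ι × κ => ℂ) 2 p (x p) =
        x p • simpleTensor φ η (φ p.1) (η p.2) := by
      rw [simpleTensor_basis, ← lp.single_smul, smul_eq_mul, mul_one]
    rw [h1, map_smul, map_smul, h]
  have h1 := hx.mapL T
  simp only [key] at h1
  exact h1.unique (hx.mapL T')

/-- A sesquilinear map that multiplies inner products extends to an isometry of the Hilbert tensor
product. -/
theorem exists_linearIsometry_tensorSpace {E : Type*} [NormedAddCommGroup E]
    [InnerProductSpace ℂ E] [CompleteSpace E] (φ : HilbertBasis ι ℂ W) (η : HilbertBasis κ ℂ S)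
    (Θ : W → S → E)
    (hΘ : ∀ f₁ f₂ s₁ s₂, inner ℂ (Θ f₂ s₂) (Θ f₁ s₁) = inner ℂ s₂ s₁ * inner ℂ f₁ f₂) :
    ∃ V : TensorSpace φ η →ₗᵢ[ℂ] E, ∀ f s, V (simpleTensor φ η f s) = Θ f s := by
  classical
  have horth : Orthonormal ℂ fun p : ι × κ => Θ (φ p.1) (η p.2) := by
    rw [orthonormal_iff_ite]
    rintro ⟨n, m⟩ ⟨n', m'⟩
    rw [hΘ, orthonormal_iff_ite.1 φ.orthonormal, orthonormal_iff_ite.1 η.orthonormal]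
    simp only [eq_comm (a := n'), Prod.mk.injEq]
    by_cases h1 : n = n' <;> by_cases h2 : m = m' <;> simp [h1, h2]
  let V : TensorSpace φ η →ₗᵢ[ℂ] E := horth.orthogonalFamily.linearIsometry
  refine ⟨V, fun f s => ?_⟩
  set x := simpleTensor φ η f s with hx
  have hcoef : ∀ p : ι × κ, inner ℂ (Θ (φ p.1) (η p.2)) (Θ f s) = x p := fun p => by
    rw [hΘ, hx]
    change _ = conj (φ.repr f p.1) * η.repr s p.2
    rw [φ.repr_apply_apply, η.repr_apply_apply, inner_conj_symm, mul_comm]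
  have hV : HasSum (fun p => x p • Θ (φ p.1) (η p.2)) (V x) :=
    horth.orthogonalFamily.hasSum_linearIsometry x
  -- Neither additivity nor continuity of Θ is available. Instead Θ f s and V x have norm ‖x‖ and
  -- inner product ‖x‖², so their difference has norm zero.
  have h1 : inner ℂ (Θ f s) (V x) = inner ℂ x x := by
    refine (hV.mapL (innerSL ℂ (Θ f s))).unique ?_
    have hterm : ∀ p, innerSL ℂ (Θ f s) (x p • Θ (φ p.1) (η p.2)) = inner ℂ (x p) (x p) :=
      fun p => by
        rw [innerSL_apply_apply, inner_smul_right, ← inner_conj_symm, hcoef, RCLike.inner_apply]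
    simp only [hterm]
    exact lp.hasSum_inner x x
  have h2 : ‖Θ f s‖ = ‖x‖ := by
    rw [hx, norm_simpleTensor]
    refine (pow_left_inj₀ (norm_nonneg _) (by positivity) two_ne_zero).1 ?_
    have h3 := hΘ f f s s
    simp only [inner_self_eq_norm_sq_to_K] at h3
    rw [mul_pow, mul_comm]
    exact_mod_cast h3
  rw [← sub_eq_zero, ← norm_eq_zero, ← sq_eq_zero_iff, @norm_sub_sq ℂ, V.norm_map, h2,
    inner_re_symm, h1, inner_self_eq_norm_sq]
  ring

end Tensor

/-! ### Extension to the window space and the Plancherel theorem. -/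

section Plancherel

variable {G : Type*} [Group G] [TopologicalSpace G] [IsTopologicalGroup G] [MeasurableSpace G]
  [BorelSpace G] {μ : Measure G} [μ.IsHaarMeasure] {S : Type*} [NormedAddCommGroup S]
  [InnerProductSpace ℂ S] [CompleteSpace S] {π : G →* (S ≃ₗᵢ[ℂ] S)} {K : S →ₗ.[ℂ] S}

/-- The wavelet transform extends from windows to the window space. -/
theorem IsDufloMoore.exists_extension (hπ : IsSquareIntegrableRep π μ) (hK : IsDufloMoore π μ K) :
    ∃ Θ : WindowSpace K →L⋆[ℂ] S →L[ℂ] Lp ℂ 2 μ,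
      (∀ (f : K.domain) (s : S), Θ (toWindowSpace K f) s =ᵐ[μ] waveletTransform π (f : S) s) ∧
      ∀ f₁ f₂ s₁ s₂, inner ℂ (Θ f₂ s₂) (Θ f₁ s₁) = inner ℂ s₂ s₁ * inner ℂ f₁ f₂ := by
  have hwin : ∀ f : K.domain, IsWindow π μ (f : S) := fun f => (hK.mem_domain f).1 f.2
  have hinner : ∀ (f₁ f₂ : K.domain) (s₁ s₂ : S),
      inner ℂ (hπ.waveletLp (hwin f₂) s₂) (hπ.waveletLp (hwin f₁) s₁) =
        inner ℂ s₂ s₁ * inner ℂ (K f₁) (K f₂) := fun f₁ f₂ s₁ s₂ => by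
    rw [hπ.inner_waveletLp, hK.orthogonality]
  have hnorm : ∀ (f : K.domain) (s : S), ‖hπ.waveletLp (hwin f) s‖ = ‖K f‖ * ‖s‖ := by
    intro f s
    refine (pow_left_inj₀ (norm_nonneg _) (by positivity) two_ne_zero).1 ?_
    have h3 := hinner f f s s
    simp only [inner_self_eq_norm_sq_to_K] at h3
    rw [mul_pow, mul_comm]
    exact_mod_cast h3
  let θ : WindowPreSpace K →ₛₗ[starRingEnd ℂ] S →L[ℂ] Lp ℂ 2 μ :=
    { toFun f := hπ.waveletLp (hwin f)
      map_add' f₁ f₂ := by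
        ext1 s
        refine Lp.ext ?_
        refine (hπ.coeFn_waveletLp _ s).trans (Filter.EventuallyEq.trans ?_
          (Lp.coeFn_add _ _).symm)
        filter_upwards [hπ.coeFn_waveletLp (hwin f₁) s, hπ.coeFn_waveletLp (hwin f₂) s]
          with g h1 h2
        refine Eq.trans ?_ (congrArg₂ (· + ·) h1 h2).symm
        exact (congrArg (inner ℂ · s) (map_add (π g) _ _)).trans (inner_add_left _ _ _)
      map_smul' c f := by
        ext1 s
        refine Lp.ext ?_
        refine (hπ.coeFn_waveletLp _ s).trans (Filter.EventuallyEq.trans ?_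
          (Lp.coeFn_smul _ _).symm)
        filter_upwards [hπ.coeFn_waveletLp (hwin f) s] with g h1
        refine Eq.trans ?_ (congrArg (conj c * ·) h1).symm
        exact (congrArg (inner ℂ · s) (map_smul (π g) _ _)).trans (inner_smul_left _ _ _) }
  -- The bound is 1 because the norm of the window space is ‖K f‖ and ‖V_f[s]‖ = ‖K f‖ ‖s‖.
  let θc : WindowPreSpace K →L⋆[ℂ] S →L[ℂ] Lp ℂ 2 μ := θ.mkContinuous 1 fun f => by
    rw [one_mul]
    exact ContinuousLinearMap.opNorm_le_bound _ (norm_nonneg _) fun s => (hnorm f s).le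
  let e : WindowPreSpace K →L[ℂ] WindowSpace K := UniformSpace.Completion.toComplL
  let Θ : WindowSpace K →L⋆[ℂ] S →L[ℂ] Lp ℂ 2 μ := θc.extend e
  have hΘ : ∀ (f : K.domain) s, Θ (toWindowSpace K f) s = hπ.waveletLp (hwin f) s := fun f s =>
    congrArg (fun T : S →L[ℂ] Lp ℂ 2 μ => T s) (θc.extend_eq (e := e)
      UniformSpace.Completion.denseRange_coe
      (UniformSpace.Completion.isUniformInducing_coe (WindowPreSpace K)) f)
  refine ⟨Θ, fun f s => ?_, fun f₁ f₂ s₁ s₂ => ?_⟩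
  · rw [hΘ]
    exact hπ.coeFn_waveletLp _ s
  · have hcont : ∀ s, Continuous fun f => Θ f s := fun s =>
      (ContinuousLinearMap.apply ℂ (Lp ℂ 2 μ) s).continuous.comp Θ.continuous
    refine UniformSpace.Completion.induction_on₂ f₁ f₂ (isClosed_eq
      (((hcont s₂).comp continuous_snd).inner ((hcont s₁).comp continuous_fst))
      (continuous_const.mul (continuous_fst.inner continuous_snd))) fun a b => ?_
    have h1 := hΘ a s₁
    have h2 := hΘ b s₂
    rw [UniformSpace.Completion.inner_coe]
    exact (congrArg₂ (inner ℂ) h2 h1).trans (hinner a b s₁ s₂)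

end Plancherel

theorem mainTheorem1 {G : Type*} [Group G] [TopologicalSpace G] [IsTopologicalGroup G]
    [LocallyCompactSpace G] [MeasurableSpace G] [BorelSpace G]
    (μ : Measure G) [μ.IsHaarMeasure] [μ.Regular]
    {S : Type*} [NormedAddCommGroup S] [InnerProductSpace ℂ S] [CompleteSpace S]
    (π : G →* (S ≃ₗᵢ[ℂ] S)) (hπ : IsSquareIntegrableRep π μ) :
    (∃ K : S →ₗ.[ℂ] S, IsDufloMoore π μ K) ∧
    ∀ K : S →ₗ.[ℂ] S, IsDufloMoore π μ K →
      ∀ {ι κ : Type*} (φ : HilbertBasis ι ℂ (WindowSpace K)) (η : HilbertBasis κ ℂ S),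
        ∃ V : TensorSpace φ η →ₗᵢ[ℂ] Lp ℂ 2 μ,
          (∀ (f : K.domain) (s : S),
            V (simpleTensor φ η (toWindowSpace K f) s) =ᵐ[μ] waveletTransform π (f : S) s) ∧
          (∀ V' : TensorSpace φ η →L[ℂ] Lp ℂ 2 μ,
            (∀ (f : K.domain) (s : S),
              V' (simpleTensor φ η (toWindowSpace K f) s) =ᵐ[μ] waveletTransform π (f : S) s) →
            V' = V.toContinuousLinearMap) ∧
          ∃ U : TensorSpace φ η ≃ₗᵢ[ℂ] LinearMap.range V.toLinearMap,
            ∀ F : TensorSpace φ η, (U F : Lp ℂ 2 μ) = V F := by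
  refine ⟨hπ.exists_isDufloMoore, fun K hK {ι κ} φ η => ?_⟩
  obtain ⟨Θ, hΘ, hΘinner⟩ := hK.exists_extension hπ
  obtain ⟨V, hV⟩ := exists_linearIsometry_tensorSpace φ η (fun f s => Θ f s) hΘinner
  refine ⟨V, fun f s => ?_, fun V' hV' => ?_, V.equivRange, fun F => rfl⟩
  · rw [hV]
    exact hΘ f s
  · refine TensorSpace.clm_ext φ η fun p => ?_
    -- The basis vector φₙ need not come from dom K, so agreement on dom K is carried to it by
    -- density and continuity.
    refine UniformSpace.Completion.induction_on (φ p.1) (isClosed_eq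
      (V'.continuous.comp (continuous_simpleTensor_left φ η (η p.2)))
      (V.continuous.comp (continuous_simpleTensor_left φ η (η p.2)))) fun f => ?_
    refine Lp.ext ((hV' f (η p.2)).trans ?_)
    have h1 := hV (toWindowSpace K f) (η p.2)
    refine (hΘ f (η p.2)).symm.trans ?_
    rw [← h1]
    rfl
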